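/- Let $K$ be a field, $R=K[x_1,\dots,x_n]$, and let $I\subset R$ be a monomial ideal. A standard linear weighting is a tuple $w=(w_1,\dots,w_n)$ of positive integers, and $I_w$ is the ideal generated by the monomials $x_1^{w_1a_1}\cdots x_n^{w_na_n}$ with $x_1^{a_1}\cdots x_n^{a_n}\in I$. The ideal $I$ is said to have a standard linear weighting if $I=J_w$ for some squarefree monomial ideal $J\subset R$ and some standard linear weighting $w$. Let $I^{(s)}=\bigcap_{\mathfrak p\in\mathrm{Ass}(R/I)}(I^sR_{\mathfrak p}\cap R)$ be the $s$-th symbolic power of $I$, and put $$\rho(I)=\sup\Big\{\tfrac st: s,t\ge 1,\ I^{(s)}\not\subset I^t\Big\},\qquad \rho_a(I)=\sup\Big\{\tfrac st: s,t\ge 1,\ I^{(sp)}\not\subset I^{tp}\text{ for all } p\gg0\Big\}$$ (suprema in the extended real numbers). **Theorem.** For every monomial ideal $I\subset R$ and every standard linear weighting $w$, $\rho(I_w)=\rho(I)$ and $\rho_a(I_w)=\rho_a(I)$. Moreover, if $I\neq R$ has a standard linear weighting and big-height $h$ (the maximum of the heights of the associated primes of $I$), and $\mathcal H_I$ is a hypergraph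 on the vertex set $\{1,\dots,n\}$ whose cover ideal is $\sqrt I$, then $$\rho_a(I)\le h-\frac1{\chi(\mathcal H_I)}.$$ Here the cover ideal of a hypergraph is generated by the monomials $\prod_{i\in C}x_i$, where $C$ ranges over the sets of vertices that meet every edge, and $\chi(\mathcal H_I)$ is the least number of colors with which the vertices can be colored so that each edge has at least two vertices of different colors; if there is no such coloring, then $\chi(\mathcal H_I)=\infty$ and $1/\chi(\mathcal H_I)=0$. -/

import Mathlib

open MvPolynomial

noncomputable section

namespace MonomialResurgence

/-! ### Ideals: associated primes, big-height, symbolic powers, resurgence -/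

section Ideals

variable {R : Type*} [CommRing R]

/-- The prime ideal `p` is an associated prime of the ideal `I`:
`p` is the annihilator `{g | f * g ∈ I}` of the class of some `f` in `R / I`. -/
def IsAssocPrime (I p : Ideal R) : Prop :=
  p.IsPrime ∧ ∃ f : R, ∀ g : R, g ∈ p ↔ f * g ∈ I

/-- The big-height of `I`: the largest height of an associated prime of `I`. -/
def bigHeight (I : Ideal R) : ℕ∞ :=
  ⨆ (p : Ideal R) (_ : IsAssocPrime I p), p.height

/-- The `s`-th symbolic power of `I`: the intersection of the contractions of `I ^ s R_p`
to `R`, over all associated primes `p` of `I`. -/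
def symbolicPower (I : Ideal R) (s : ℕ) : Ideal R :=
  ⨅ (p : PrimeSpectrum R) (_ : IsAssocPrime I p.asIdeal),
    ((I ^ s).map (algebraMap R (Localization.AtPrime p.asIdeal))).comap
      (algebraMap R (Localization.AtPrime p.asIdeal))

/-- The resurgence of `I`, as a supremum in the extended reals. -/
def resurgence (I : Ideal R) : EReal :=
  sSup {r : EReal | ∃ s t : ℕ, 0 < s ∧ 0 < t ∧
    ¬ symbolicPower I s ≤ I ^ t ∧ r = (((s : ℝ) / (t : ℝ) : ℝ) : EReal)}

/-- The asymptotic resurgence of `I`, as a supremum in the extended reals. -/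
def asymptoticResurgence (I : Ideal R) : EReal :=
  sSup {r : EReal | ∃ s t : ℕ, 0 < s ∧ 0 < t ∧
    (∀ᶠ p : ℕ in Filter.atTop, ¬ symbolicPower I (s * p) ≤ I ^ (t * p)) ∧
    r = (((s : ℝ) / (t : ℝ) : ℝ) : EReal)}

end Ideals

/-! ### Monomial ideals and weightings -/

section Monomial

variable {K : Type*} [Field K] {n : ℕ}

/-- An ideal generated by a set of monomials. -/
def IsMonomialIdeal (I : Ideal (MvPolynomial (Fin n) K)) : Prop :=
  ∃ S : Set (Fin n →₀ ℕ), I = Ideal.span ((fun a => monomial a (1 : K)) '' S)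

/-- An ideal generated by a set of squarefree monomials. -/
def IsSquarefreeMonomialIdeal (I : Ideal (MvPolynomial (Fin n) K)) : Prop :=
  ∃ S : Set (Fin n →₀ ℕ), (∀ a ∈ S, ∀ i, a i ≤ 1) ∧
    I = Ideal.span ((fun a => monomial a (1 : K)) '' S)

/-- The exponent `w(a) = (w₁ a₁, …, wₙ aₙ)`. -/
def weightExponent (w : Fin n → ℕ) (a : Fin n →₀ ℕ) : Fin n →₀ ℕ :=
  Finsupp.equivFunOnFinite.symm (fun i => w i * a i)

/-- The weighted ideal `I_w`, generated by the monomials `x ^ w(a)` with `x ^ a ∈ I`. -/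
def weightedIdeal (w : Fin n → ℕ) (I : Ideal (MvPolynomial (Fin n) K)) :
    Ideal (MvPolynomial (Fin n) K) :=
  Ideal.span {f | ∃ a : Fin n →₀ ℕ, monomial a (1 : K) ∈ I ∧
    f = monomial (weightExponent w a) (1 : K)}

/-- `w = (w₁, …, wₙ)` is a standard linear weighting: all the `wᵢ` are positive integers. -/
def IsStandardWeighting (w : Fin n → ℕ) : Prop := ∀ i, 0 < w i

/-- `I = J_w` for some squarefree monomial ideal `J` and some standard linear weighting `w`. -/
def HasStandardLinearWeighting (I : Ideal (MvPolynomial (Fin n) K)) : Prop :=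
  ∃ (J : Ideal (MvPolynomial (Fin n) K)) (w : Fin n → ℕ),
    IsSquarefreeMonomialIdeal J ∧ IsStandardWeighting w ∧ I = weightedIdeal w J

end Monomial

/-! ### Hypergraphs -/

section Hypergraphs

/-- The vertices of `H` can be coloured with `k` colours in such a way that each edge
has two vertices of different colours. -/
def IsColorable {V : Type*} (H : Hypergraph V) (k : ℕ) : Prop :=
  ∃ c : H.vertexSet → Fin k, ∀ e ∈ H.edgeSet,
    ∃ x y : H.vertexSet, (x : V) ∈ e ∧ (y : V) ∈ e ∧ c x ≠ c y

/-- The chromatic number of `H`; it is `⊤` if no number of colours suffices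
(which happens, for finite `H`, exactly when some edge has at most one vertex). -/
def chromaticNumber {V : Type*} (H : Hypergraph V) : ℕ∞ :=
  ⨅ (k : ℕ) (_ : IsColorable H k), (k : ℕ∞)

/-- `C` is a vertex cover of `H`: it meets every edge. -/
def IsVertexCover {V : Type*} (H : Hypergraph V) (C : Finset V) : Prop :=
  (∀ i ∈ C, i ∈ H.vertexSet) ∧ ∀ e ∈ H.edgeSet, ∃ i ∈ C, i ∈ e

variable {n : ℕ}

/-- The cover ideal of `H`, generated by the products of the variables over the
vertex covers of `H`. -/
def coverIdeal (K : Type*) [Field K] (H : Hypergraph (Fin n)) :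
    Ideal (MvPolynomial (Fin n) K) :=
  Ideal.span {f | ∃ C : Finset (Fin n), IsVertexCover H C ∧ f = ∏ i ∈ C, X i}

/-- `H` is a hypergraph `H_I` of `I`: a hypergraph on the vertices `1, …, n` with cover ideal
the radical of `I`. -/
def IsHypergraphOf {K : Type*} [Field K] (H : Hypergraph (Fin n))
    (I : Ideal (MvPolynomial (Fin n) K)) : Prop :=
  H.vertexSet = Set.univ ∧ coverIdeal K H = I.radical

/-- The simple hypergraph whose edges are the minimal `A` with `I ≤ ⟨xᵢ : i ∈ A⟩`. -/
def simpleHypergraphOf {K : Type*} [Field K] (I : Ideal (MvPolynomial (Fin n) K)) :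
    Hypergraph (Fin n) where
  vertexSet := Set.univ
  edgeSet := {A | Minimal (fun B : Set (Fin n) =>
    I ≤ Ideal.span ((X : Fin n → MvPolynomial (Fin n) K) '' B)) A}
  subset_vertexSet_of_mem_edgeSet' := fun _ _ => Set.subset_univ _

theorem radical_le_span_X {K : Type*} [Field K] {I : Ideal (MvPolynomial (Fin n) K)}
    {A : Set (Fin n)} (h : I ≤ Ideal.span ((X : Fin n → MvPolynomial (Fin n) K) '' A)) :
    I.radical ≤ Ideal.span ((X : Fin n → MvPolynomial (Fin n) K) '' A) := by
  classical
  let φ : MvPolynomial (Fin n) K →ₐ[K] MvPolynomial (Fin n) K :=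
    aeval (fun i => if i ∈ A then 0 else X i)
  have hker : ∀ f ∈ Ideal.span ((X : Fin n → MvPolynomial (Fin n) K) '' A), φ f = 0 := by
    intro f hf
    have : Ideal.span ((X : Fin n → MvPolynomial (Fin n) K) '' A) ≤ RingHom.ker φ := by
      rw [Ideal.span_le]
      rintro _ ⟨i, hi, rfl⟩
      simp [φ, hi, RingHom.mem_ker]
    exact this hf
  have hsub : ∀ f, f - φ f ∈ Ideal.span ((X : Fin n → MvPolynomial (Fin n) K) '' A) := by
    intro f
    rw [← Ideal.Quotient.eq]
    have : (Ideal.Quotient.mkₐ K (Ideal.span ((X : Fin n → MvPolynomial (Fin n) K) '' A))) =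
        (Ideal.Quotient.mkₐ K (Ideal.span ((X : Fin n → MvPolynomial (Fin n) K) '' A))).comp φ := by
      ext i
      by_cases hi : i ∈ A
      · simp only [AlgHom.comp_apply, φ, aeval_X, hi, if_true, map_zero]
        exact Ideal.Quotient.eq_zero_iff_mem.mpr (Ideal.subset_span ⟨i, hi, rfl⟩)
      · simp only [AlgHom.comp_apply, φ, aeval_X, hi, if_false]
    exact DFunLike.congr_fun this f
  intro f hf
  obtain ⟨N, hN⟩ := hf
  have h0 : φ f = 0 := by
    have := hker _ (h hN)
    rw [map_pow] at this
    exact eq_zero_of_pow_eq_zero this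
  simpa [h0] using hsub f

theorem isHypergraphOf_simpleHypergraphOf {K : Type*} [Field K]
    {I : Ideal (MvPolynomial (Fin n) K)} (hI : IsMonomialIdeal I) :
    IsHypergraphOf (simpleHypergraphOf I) I := by
  classical
  refine ⟨rfl, le_antisymm ?_ ?_⟩
  · obtain ⟨S, hS⟩ := hI
    rw [coverIdeal, Ideal.span_le]
    rintro _ ⟨C, ⟨-, hC⟩, rfl⟩
    obtain ⟨a, ha, hac⟩ : ∃ a ∈ S, ∀ i, a i ≠ 0 → i ∈ C := by
      by_contra hcon
      push Not at hcon
      have hle : I ≤ Ideal.span ((X : Fin n → MvPolynomial (Fin n) K) '' {i | i ∉ C}) := by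
        rw [hS, Ideal.span_le]
        rintro _ ⟨a, ha, rfl⟩
        obtain ⟨i, hi, hiC⟩ := hcon a ha
        rw [SetLike.mem_coe, mem_ideal_span_X_image]
        intro m hm
        have := support_monomial_subset hm
        rw [Finset.mem_singleton] at this
        exact ⟨i, hiC, this ▸ hi⟩
      obtain ⟨B, hB, hmin⟩ := exists_minimal_le_of_wellFoundedLT
        (fun B : Set (Fin n) =>
          I ≤ Ideal.span ((X : Fin n → MvPolynomial (Fin n) K) '' B)) _ hle
      obtain ⟨i, hi, hiB⟩ := hC B hmin
      exact hB hiB hi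
    refine ⟨∑ i, a i, ?_⟩
    have hmem : monomial a (1 : K) ∈ I := hS ▸ Ideal.subset_span ⟨a, ha, rfl⟩
    refine Ideal.mem_of_dvd I ?_ hmem
    rw [monomial_eq, C_1, one_mul, Finsupp.prod, ← Finset.prod_pow]
    have hsub : a.support ⊆ C := fun i hi => hac i (Finsupp.mem_support_iff.mp hi)
    refine dvd_trans (Finset.prod_dvd_prod_of_dvd _ _ fun i _ => ?_)
      (Finset.prod_dvd_prod_of_subset _ _ _ hsub)
    exact pow_dvd_pow _ (Finset.single_le_sum (f := fun i => a i)
      (fun _ _ => Nat.zero_le _) (Finset.mem_univ i))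
  · intro f hf
    rw [f.as_sum]
    refine Ideal.sum_mem _ fun m hm => ?_
    have hcov : IsVertexCover (simpleHypergraphOf I) m.support := by
      refine ⟨fun _ _ => trivial, fun A hA => ?_⟩
      obtain ⟨i, hi, him⟩ := mem_ideal_span_X_image.mp (radical_le_span_X hA.1 hf) m hm
      exact ⟨i, Finsupp.mem_support_iff.mpr him, hi⟩
    have hgen : (∏ i ∈ m.support, (X i : MvPolynomial (Fin n) K)) ∈
        coverIdeal K (simpleHypergraphOf I) := Ideal.subset_span ⟨_, hcov, rfl⟩
    refine Ideal.mem_of_dvd _ ?_ hgen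
    rw [monomial_eq, Finsupp.prod]
    refine Dvd.dvd.mul_left (Finset.prod_dvd_prod_of_dvd _ _ fun i hi => ?_) _
    exact dvd_pow_self _ (Finsupp.mem_support_iff.mp hi)

end Hypergraphs

end MonomialResurgence

end

noncomputable section

namespace MonomialResurgence

variable {K : Type*} [Field K] {n : ℕ}

/-! ### Monomial ideals and their exponents -/

/-! Everything is reduced to exponents. A monomial `x ^ a` lies in `I_w` iff `x ^ ⌊a / w⌋` lies in
`I`. Weighting commutes with powers, because `I_w` is the extension of `I` along `x_i ↦ x_i ^ w_i`,
and it preserves the associated primes, which are all generated by variables. Moreover `x ^ a ∈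
I^(s)` iff for each associated set `A` some monomial in the variables outside `A` multiplies `x ^ a`
into `I ^ s` (`mem_symbolicPower_iff`). Hence `I_w^(s) ⊆ I_w ^ t` iff `I^(s) ⊆ I ^ t`, for every
pair `s, t` separately, and both resurgences agree.

For the bound one may therefore replace `I = J_w` by the squarefree ideal `J`. If `x ^ a ∈ J^(s)`,
then the sum of `a` over each associated set `A` is at least `s`, while `|A| ≤ h`. In a colouring
with `k` colours the complement of each colour class is a cover. Combining these covers with the
sizes of the `a i` gives `k` squarefree monomials of `J`, one per colour, whose product to the power
`τ` divides `x ^ a` as soon as `s ≥ (h - 1/k) k τ` (`symbolicPower_le_pow_of_colouring`). So `J^(s)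
⊆ J ^ (k τ)`. Since `ρ_a` requires failure for all large `p`, containment along the multiples of `k`
suffices. If there is no colouring, the single cover `{i | t ≤ a i}` gives the bound `h`. -/

theorem IsMonomialIdeal.mem_iff {I : Ideal (MvPolynomial (Fin n) K)} (hI : IsMonomialIdeal I)
    {f : MvPolynomial (Fin n) K} :
    f ∈ I ↔ ∀ a ∈ f.support, monomial a (1 : K) ∈ I := by
  obtain ⟨S, rfl⟩ := hI
  simp only [mem_ideal_span_monomial_image]
  refine forall₂_congr fun a _ => ?_
  simp 

theorem monomial_mem_of_le {I : Ideal (MvPolynomial (Fin n) K)} {a b : Fin n →₀ ℕ} (hab : a ≤ b)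
    (ha : monomial a (1 : K) ∈ I) : monomial b (1 : K) ∈ I :=
  Ideal.mem_of_dvd I (by simp [monomial_dvd_monomial, hab]) ha

theorem IsMonomialIdeal.mul {I J : Ideal (MvPolynomial (Fin n) K)} (hI : IsMonomialIdeal I)
    (hJ : IsMonomialIdeal J) : IsMonomialIdeal (I * J) := by
  obtain ⟨S, rfl⟩ := hI
  obtain ⟨T, rfl⟩ := hJ
  refine ⟨Set.image2 (· + ·) S T, ?_⟩
  rw [Ideal.span_mul_span', Set.image_image2]
  congr 1
  rw [← Set.image2_mul, Set.image2_image_left, Set.image2_image_right]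
  simp [monomial_mul]

theorem IsMonomialIdeal.pow {I : Ideal (MvPolynomial (Fin n) K)} (hI : IsMonomialIdeal I)
    (s : ℕ) : IsMonomialIdeal (I ^ s) := by
  induction s with
  | zero =>
    refine ⟨{0}, ?_⟩
    rw [pow_zero, Ideal.one_eq_top, Set.image_singleton]
    exact (Ideal.span_singleton_one).symm
  | succ s ih => rw [pow_succ]; exact ih.mul hI

/-- The ideal generated by the variables with index in `A`. -/
def varIdeal (K : Type*) [Field K] (A : Set (Fin n)) : Ideal (MvPolynomial (Fin n) K) :=
  Ideal.span ((X : Fin n → MvPolynomial (Fin n) K) '' A)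

theorem mem_varIdeal {A : Set (Fin n)} {f : MvPolynomial (Fin n) K} :
    f ∈ varIdeal K A ↔ ∀ a ∈ f.support, ∃ i ∈ A, a i ≠ 0 :=
  mem_ideal_span_X_image

theorem monomial_mem_varIdeal {A : Set (Fin n)} {a : Fin n →₀ ℕ} :
    monomial a (1 : K) ∈ varIdeal K A ↔ ∃ i ∈ A, a i ≠ 0 := by
  simp [mem_varIdeal]

theorem X_mem_varIdeal {A : Set (Fin n)} {i : Fin n} :
    (X i : MvPolynomial (Fin n) K) ∈ varIdeal K A ↔ i ∈ A := by
  rw [X, monomial_mem_varIdeal]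
  simp [Finsupp.single_apply]

theorem isMonomialIdeal_varIdeal (A : Set (Fin n)) : IsMonomialIdeal (varIdeal K A) :=
  ⟨(fun i => Finsupp.single i 1) '' A, by rw [varIdeal, Set.image_image]; rfl⟩

/-! ### Saturation with respect to the complement of a monomial prime -/

/-- The exponents ordered by their degree in the variables of `A`, then lexicographically. -/
def blockKey (A : Set (Fin n)) [DecidablePred (· ∈ A)] (a : Fin n →₀ ℕ) :
    ℕ ×ₗ Lex (Fin n →₀ ℕ) :=
  toLex (∑ i with i ∈ A, a i, toLex a)

theorem blockKey_add (A : Set (Fin n)) [DecidablePred (· ∈ A)] (a b : Fin n →₀ ℕ) :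
    blockKey A (a + b) = blockKey A a + blockKey A b := by
  simp only [blockKey, Finsupp.add_apply, Finset.sum_add_distrib]
  rfl

theorem blockKey_injective (A : Set (Fin n)) [DecidablePred (· ∈ A)] :
    Function.Injective (blockKey A) := by
  intro a b hab
  have h := congrArg (fun x => (ofLex x).2) hab
  exact toLex.injective h

/-- This is an initial-term argument. Ordering by degree in `A` first makes the least term of `g`
free of the variables of `A`. It is paired with the least term of `f` that violates the claim. -/
theorem saturate_of_mul_mem {I : Ideal (MvPolynomial (Fin n) K)} (hI : IsMonomialIdeal I)
    {A : Set (Fin n)} {f g : MvPolynomial (Fin n) K} (hg : g ∉ varIdeal K A) (hfg : f * g ∈ I) :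
    ∀ a ∈ f.support, ∃ b : Fin n →₀ ℕ, (∀ i ∈ A, b i = 0) ∧ monomial (a + b) (1 : K) ∈ I := by
  classical
  let Q : Set (Fin n →₀ ℕ) :=
    {a | ∃ b : Fin n →₀ ℕ, (∀ i ∈ A, b i = 0) ∧ monomial (a + b) (1 : K) ∈ I}
  have hQ : ∀ {a c}, a ≤ c → a ∈ Q → c ∈ Q := by
    rintro a c hac ⟨b, hb, hab⟩
    exact ⟨b, hb, monomial_mem_of_le (by gcongr) hab⟩
  by_contra! hcon
  obtain ⟨a₁, ha₁, ha₁Q⟩ := hcon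
  have hne : (f.support.filter (· ∉ Q)).Nonempty :=
    ⟨a₁, Finset.mem_filter.2 ⟨ha₁, fun ⟨b, hb, hab⟩ => ha₁Q b hb hab⟩⟩
  obtain ⟨b₁, hb₁, hb₁A⟩ : ∃ b ∈ g.support, ∀ i ∈ A, b i = 0 := by
    rw [mem_varIdeal] at hg
    push Not at hg
    exact hg
  obtain ⟨a₀, ha₀, hamin⟩ := Finset.exists_min_image _ (blockKey A) hne
  obtain ⟨b₀, hb₀, hbmin⟩ := Finset.exists_min_image g.support (blockKey A) ⟨b₁, hb₁⟩
  rw [Finset.mem_filter] at ha₀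
  have hb₀A : ∀ i ∈ A, b₀ i = 0 := by
    have h1 : ∑ i with i ∈ A, b₀ i ≤ ∑ i with i ∈ A, b₁ i := by
      rcases (Prod.Lex.le_iff.1 (hbmin b₁ hb₁)) with h | h
      · exact h.le
      · exact h.1.le
    have h2 : ∑ i with i ∈ A, b₁ i = 0 :=
      Finset.sum_eq_zero fun i hi => hb₁A i (Finset.mem_filter.1 hi).2
    rw [h2, Nat.le_zero, Finset.sum_eq_zero_iff] at h1
    exact fun i hi => h1 i (by simpa using hi)
  refine ha₀.2 ?_
  -- If the coefficient is nonzero, `b₀` itself works for `a₀`. If it vanishes, another pair `(a,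
  -- b)` with the same sum must contribute; either `a` is in `Q` and its multiplier passes to `a₀`,
  -- or minimality forces `(a, b) = (a₀, b₀)`.
  by_cases hc : coeff (a₀ + b₀) (f * g) = 0
  · rw [coeff_mul] at hc
    by_cases hz : ∀ x ∈ Finset.HasAntidiagonal.antidiagonal (a₀ + b₀), x ≠ (a₀, b₀) →
        coeff x.1 f * coeff x.2 g = 0
    · rw [Finset.sum_eq_single (a₀, b₀) hz (by simp)] at hc
      exact absurd hc (mul_ne_zero (mem_support_iff.1 ha₀.1) (mem_support_iff.1 hb₀))
    · push Not at hz
      obtain ⟨⟨a, b⟩, hab, hne, hmul⟩ := hz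
      rw [Finset.HasAntidiagonal.mem_antidiagonal] at hab
      have hb := hbmin b (mem_support_iff.2 (right_ne_zero_of_mul hmul))
      by_cases haQ : a ∈ Q
      · obtain ⟨b', hb', h'⟩ := haQ
        refine ⟨b₀ + b', fun i hi => by simp [hb₀A i hi, hb' i hi], ?_⟩
        rw [← add_assoc, ← show a + b = a₀ + b₀ from hab]
        exact monomial_mem_of_le (by rw [add_right_comm]; exact le_self_add) h'
      · have ha := hamin a (Finset.mem_filter.2
          ⟨mem_support_iff.2 (left_ne_zero_of_mul hmul), haQ⟩)
        have hkey : blockKey A a + blockKey A b = blockKey A a₀ + blockKey A b₀ := by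
          rw [← blockKey_add, ← blockKey_add]; exact congrArg _ hab
        obtain ⟨h1, h2⟩ := (add_eq_add_iff_eq_and_eq ha hb).1 hkey.symm
        exact absurd (Prod.ext (blockKey_injective A h1.symm) (blockKey_injective A h2.symm)) hne
  · exact ⟨b₀, hb₀A, hI.mem_iff.1 hfg _ (mem_support_iff.2 hc)⟩

/-- If every term of `f` is moved into `I` by a monomial avoiding the variables of `A`, then
a single such monomial does it for all of them. -/
theorem exists_mul_monomial_mem {I : Ideal (MvPolynomial (Fin n) K)} (hI : IsMonomialIdeal I)
    {A : Set (Fin n)} {f : MvPolynomial (Fin n) K}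
    (h : ∀ a ∈ f.support, ∃ b : Fin n →₀ ℕ, (∀ i ∈ A, b i = 0) ∧
      monomial (a + b) (1 : K) ∈ I) :
    ∃ b : Fin n →₀ ℕ, (∀ i ∈ A, b i = 0) ∧ f * monomial b (1 : K) ∈ I := by
  choose! β hβ hβI using h
  refine ⟨∑ a ∈ f.support, β a, fun i hi => ?_, hI.mem_iff.2 fun c hc => ?_⟩
  · rw [Finsupp.finsetSum_apply]
    exact Finset.sum_eq_zero fun a ha => hβ a ha i hi
  · rw [mem_support_iff, coeff_mul_monomial'] at hc
    obtain ⟨hac, hc⟩ := ite_ne_right_iff.1 hc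
    have hs := mem_support_iff.2 (left_ne_zero_of_mul hc)
    refine monomial_mem_of_le ?_ (hβI _ hs)
    conv_rhs => rw [← tsub_add_cancel_of_le hac]
    gcongr
    exact Finset.single_le_sum (f := β) (fun _ _ => bot_le) hs

theorem varIdeal_isPrime (A : Set (Fin n)) : (varIdeal K A).IsPrime := by
  refine ⟨fun h => ?_, fun {f g} hfg => ?_⟩
  · have h1 : monomial (0 : Fin n →₀ ℕ) (1 : K) ∈ varIdeal K A := h ▸ Submodule.mem_top
    obtain ⟨i, -, hi⟩ := monomial_mem_varIdeal.1 h1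
    exact hi rfl
  · by_cases hg : g ∈ varIdeal K A
    · exact Or.inr hg
    · refine Or.inl (mem_varIdeal.2 fun a ha => ?_)
      obtain ⟨b, hb, hab⟩ := saturate_of_mul_mem (isMonomialIdeal_varIdeal A) hg hfg a ha
      obtain ⟨i, hi, h⟩ := monomial_mem_varIdeal.1 hab
      exact ⟨i, hi, by simpa [hb i hi] using h⟩

/-- Adjoining the variables one at a time gives a strict chain of primes. -/
theorem card_le_height_varIdeal (A : Finset (Fin n)) :
    (A.card : ℕ∞) ≤ (varIdeal K (A : Set (Fin n))).height := by
  classical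
  induction A using Finset.induction_on with
  | empty => simp
  | insert i A hi ih =>
    have h1 := varIdeal_isPrime (K := K) (A : Set (Fin n))
    have h2 := varIdeal_isPrime (K := K) ((insert i A : Finset (Fin n)) : Set (Fin n))
    have hlt : varIdeal K (A : Set (Fin n)) <
        varIdeal K ((insert i A : Finset (Fin n)) : Set (Fin n)) := by
      refine lt_of_le_of_ne (Ideal.span_mono (Set.image_mono (by simp))) fun h => hi ?_
      have : (X i : MvPolynomial (Fin n) K) ∈ varIdeal K (A : Set (Fin n)) := by
        rw [h, X_mem_varIdeal]; simp
      simpa [X_mem_varIdeal] using this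
    rw [Finset.card_insert_of_notMem hi]
    rw [Nat.cast_add, Nat.cast_one]
    exact (add_le_add_left ih 1).trans (Ideal.height_add_one_le_of_lt_of_isPrime hlt)

/-! ### Associated primes and symbolic powers of monomial ideals -/

/-- The ideal generated by the variables with index in `A` is the annihilator of a monomial
modulo `I`. -/
def IsAssocSet (I : Ideal (MvPolynomial (Fin n) K)) (A : Set (Fin n)) : Prop :=
  ∃ a : Fin n →₀ ℕ, ∀ b : Fin n →₀ ℕ, monomial (a + b) (1 : K) ∈ I ↔ ∃ i ∈ A, b i ≠ 0

theorem IsAssocSet.isAssocPrime {I : Ideal (MvPolynomial (Fin n) K)} (hI : IsMonomialIdeal I)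
    {A : Set (Fin n)} (hA : IsAssocSet I A) : IsAssocPrime I (varIdeal K A) := by
  classical
  obtain ⟨a, ha⟩ := hA
  refine ⟨varIdeal_isPrime A, monomial a 1, fun g => ?_⟩
  rw [mem_varIdeal, hI.mem_iff]
  constructor
  · intro h c hc
    rw [mem_support_iff, coeff_monomial_mul'] at hc
    obtain ⟨hac, hc⟩ := ite_ne_right_iff.1 hc
    rw [← add_tsub_cancel_of_le hac, ha]
    exact h _ (mem_support_iff.2 (right_ne_zero_of_mul hc))
  · intro h b hb
    rw [← ha]
    refine h _ ?_
    rw [mem_support_iff, coeff_monomial_mul, one_mul]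
    exact mem_support_iff.1 hb

/-- Let `A` index the variables in `p = (I : f)`. Saturation shows that `p` has nothing outside
`varIdeal K A`. If no term of `f` had annihilator `varIdeal K A`, every term, hence `f`, would be
moved into `I` by a monomial outside `p`, which is absurd. -/
theorem IsAssocPrime.exists_isAssocSet {I p : Ideal (MvPolynomial (Fin n) K)}
    (hI : IsMonomialIdeal I) (hp : IsAssocPrime I p) : ∃ A, p = varIdeal K A ∧ IsAssocSet I A := by
  classical
  obtain ⟨hprime, f, hf⟩ := hp
  let A : Set (Fin n) := {i | (X i : MvPolynomial (Fin n) K) ∈ p}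
  have hmono : ∀ b : Fin n →₀ ℕ, monomial b (1 : K) ∈ p → ∃ i ∈ A, b i ≠ 0 := by
    intro b hb
    rw [monomial_eq, C_1, one_mul, Finsupp.prod] at hb
    obtain ⟨i, hi, h⟩ := (hprime.prod_mem_iff).1 hb
    exact ⟨i, hprime.mem_of_pow_mem _ h, Finsupp.mem_support_iff.1 hi⟩
  have hle : varIdeal K A ≤ p := by
    rw [varIdeal, Ideal.span_le]
    rintro _ ⟨i, hi, rfl⟩
    exact hi
  have hpA : p = varIdeal K A := by
    refine le_antisymm (fun g hg => ?_) hle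
    by_contra hgA
    obtain ⟨b, hb, hbI⟩ :=
      exists_mul_monomial_mem hI (saturate_of_mul_mem hI hgA ((hf g).1 hg))
    obtain ⟨i, hi, h⟩ := hmono b ((hf _).2 hbI)
    exact h (hb i hi)
  refine ⟨A, hpA, ?_⟩
  by_contra hcon
  have hstep : ∀ a ∈ f.support, ∃ b : Fin n →₀ ℕ, (∀ i ∈ A, b i = 0) ∧
      monomial (a + b) (1 : K) ∈ I := by
    intro a ha
    by_contra! h
    refine hcon ⟨a, fun b => ⟨fun hb => ?_, ?_⟩⟩
    · by_contra! hbA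
      exact h b hbA hb
    · rintro ⟨i, hi, hbi⟩
      have h1 : f * X i ∈ I := (hf _).1 hi
      have h2 : monomial (a + Finsupp.single i 1) (1 : K) ∈ I := by
        refine hI.mem_iff.1 h1 _ ?_
        rw [mem_support_iff, coeff_mul_X]
        exact mem_support_iff.1 ha
      refine monomial_mem_of_le ?_ h2
      gcongr
      rw [Finsupp.single_le_iff]
      omega
  obtain ⟨b, hb, hbI⟩ := exists_mul_monomial_mem hI hstep
  obtain ⟨i, hi, h⟩ := hmono b ((hf _).2 hbI)
  exact h (hb i hi)

/-- Membership in the contraction of `I ^ s R_p` means that some multiplier outside `p` moves `f`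
into `I ^ s`; saturation lets the multiplier be a monomial, chosen separately for each term. -/
theorem mem_symbolicPower_iff {I : Ideal (MvPolynomial (Fin n) K)} (hI : IsMonomialIdeal I)
    {s : ℕ} {f : MvPolynomial (Fin n) K} :
    f ∈ symbolicPower I s ↔ ∀ a ∈ f.support, ∀ A, IsAssocSet I A →
      ∃ b : Fin n →₀ ℕ, (∀ i ∈ A, b i = 0) ∧ monomial (a + b) (1 : K) ∈ I ^ s := by
  classical
  simp only [symbolicPower, Ideal.mem_iInf, Ideal.mem_comap]
  constructor
  · intro h a ha A hA
    have := h ⟨_, varIdeal_isPrime A⟩ (hA.isAssocPrime hI)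
    have hprime := varIdeal_isPrime (K := K) A
    obtain ⟨g, hg, hgf⟩ := (IsLocalization.algebraMap_mem_map_algebraMap_iff
      (varIdeal K A).primeCompl _ _ _).1 this
    exact saturate_of_mul_mem (hI.pow s) hg (by rwa [mul_comm]) a ha
  · intro h p hp
    obtain ⟨A, hpA, hA⟩ := hp.exists_isAssocSet hI
    obtain ⟨b, hb, hbI⟩ := exists_mul_monomial_mem (hI.pow s) fun a ha => h a ha A hA
    refine (IsLocalization.algebraMap_mem_map_algebraMap_iff p.asIdeal.primeCompl _ _ _).2
      ⟨monomial b 1, ?_, by rwa [mul_comm]⟩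
    rw [Ideal.mem_primeCompl_iff, hpA, monomial_mem_varIdeal]
    rintro ⟨i, hi, h⟩
    exact h (hb i hi)

/-! ### Weighted ideals -/

/-- The exponent `(⌊a₁ / w₁⌋, …, ⌊aₙ / wₙ⌋)`. -/
def floorExponent (w : Fin n → ℕ) (a : Fin n →₀ ℕ) : Fin n →₀ ℕ :=
  Finsupp.equivFunOnFinite.symm (fun i => a i / w i)

@[simp] theorem weightExponent_apply (w : Fin n → ℕ) (a : Fin n →₀ ℕ) (i : Fin n) :
    weightExponent w a i = w i * a i := rfl

@[simp] theorem floorExponent_apply (w : Fin n → ℕ) (a : Fin n →₀ ℕ) (i : Fin n) :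
    floorExponent w a i = a i / w i := rfl

theorem floorExponent_add_weightExponent {w : Fin n → ℕ} (hw : IsStandardWeighting w)
    (a b : Fin n →₀ ℕ) : floorExponent w (a + weightExponent w b) = floorExponent w a + b := by
  ext i
  simp [Nat.add_mul_div_left _ _ (hw i)]

theorem floorExponent_weightExponent {w : Fin n → ℕ} (hw : IsStandardWeighting w)
    (a : Fin n →₀ ℕ) : floorExponent w (weightExponent w a) = a := by
  ext i
  simp [Nat.mul_div_cancel_left _ (hw i)]

theorem weightedIdeal_eq_span (w : Fin n → ℕ) (I : Ideal (MvPolynomial (Fin n) K)) :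
    weightedIdeal w I = Ideal.span ((fun a => monomial a (1 : K)) ''
      (weightExponent w '' {a | monomial a (1 : K) ∈ I})) := by
  rw [weightedIdeal, Set.image_image]
  congr 1
  ext f
  simp [eq_comm]

theorem isMonomialIdeal_weightedIdeal (w : Fin n → ℕ) (I : Ideal (MvPolynomial (Fin n) K)) :
    IsMonomialIdeal (weightedIdeal w I) :=
  ⟨_, weightedIdeal_eq_span w I⟩

theorem monomial_mem_weightedIdeal {w : Fin n → ℕ} (hw : IsStandardWeighting w)
    {I : Ideal (MvPolynomial (Fin n) K)} {a : Fin n →₀ ℕ} :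
    monomial a (1 : K) ∈ weightedIdeal w I ↔ monomial (floorExponent w a) (1 : K) ∈ I := by
  classical
  rw [weightedIdeal_eq_span, mem_ideal_span_monomial_image]
  simp only [support_monomial, one_ne_zero, if_false, Finset.mem_singleton, forall_eq,
    Set.exists_mem_image, Set.mem_ofPred_eq]
  constructor
  · rintro ⟨c, hc, hca⟩
    refine monomial_mem_of_le (fun i => ?_) hc
    rw [floorExponent_apply, Nat.le_div_iff_mul_le (hw i), mul_comm]
    exact hca i
  · exact fun h => ⟨_, h, fun i => Nat.mul_div_le _ _⟩

theorem aeval_monomial_weight (w : Fin n → ℕ) (a : Fin n →₀ ℕ) :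
    aeval (fun i => (X i : MvPolynomial (Fin n) K) ^ w i) (monomial a (1 : K)) =
      monomial (weightExponent w a) 1 := by
  rw [aeval_monomial, map_one, one_mul, monomial_eq, C_1, one_mul,
    Finsupp.prod_fintype _ _ (by simp), Finsupp.prod_fintype _ _ (by simp)]
  simp [pow_mul]

/-- Seen as an extension of ideals along a ring homomorphism, weighting visibly commutes with
powers. -/
theorem weightedIdeal_eq_map (w : Fin n → ℕ) {I : Ideal (MvPolynomial (Fin n) K)}
    (hI : IsMonomialIdeal I) : weightedIdeal w I =
      I.map (aeval (R := K) (fun i => (X i : MvPolynomial (Fin n) K) ^ w i)) := by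
  refine le_antisymm ?_ ?_
  · rw [weightedIdeal, Ideal.span_le]
    rintro _ ⟨a, ha, rfl⟩
    rw [← aeval_monomial_weight]
    exact Ideal.mem_map_of_mem _ ha
  · obtain ⟨S, hS⟩ := id hI
    conv_lhs => rw [hS]
    rw [Ideal.map_span, Ideal.span_le]
    rintro _ ⟨_, ⟨a, ha, rfl⟩, rfl⟩
    refine Ideal.subset_span ⟨a, ?_, aeval_monomial_weight w a⟩
    rw [hS]
    exact Ideal.subset_span ⟨a, ha, rfl⟩

theorem weightedIdeal_pow (w : Fin n → ℕ) {I : Ideal (MvPolynomial (Fin n) K)}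
    (hI : IsMonomialIdeal I) (s : ℕ) : weightedIdeal w I ^ s = weightedIdeal w (I ^ s) := by
  rw [weightedIdeal_eq_map w hI, weightedIdeal_eq_map w (hI.pow s), Ideal.map_pow]

theorem isAssocSet_weightedIdeal_iff {w : Fin n → ℕ} (hw : IsStandardWeighting w)
    {I : Ideal (MvPolynomial (Fin n) K)} {A : Set (Fin n)} :
    IsAssocSet (weightedIdeal w I) A ↔ IsAssocSet I A := by
  constructor
  · rintro ⟨a, ha⟩
    refine ⟨floorExponent w a, fun b => ?_⟩
    rw [← floorExponent_add_weightExponent hw, ← monomial_mem_weightedIdeal hw, ha]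
    simp [(hw _).ne']
  · rintro ⟨a, ha⟩
    -- This is the largest exponent whose floor is `a`, so adding `b` raises the floor in coordinate
    -- `i` exactly when `b i ≠ 0`.
    refine ⟨weightExponent w a + Finsupp.equivFunOnFinite.symm (fun i => w i - 1), fun b => ?_⟩
    have hfloor : floorExponent w (weightExponent w a +
        Finsupp.equivFunOnFinite.symm (fun i => w i - 1) + b) =
        a + floorExponent w (Finsupp.equivFunOnFinite.symm (fun i => w i - 1) + b) := by
      rw [add_assoc, add_comm, floorExponent_add_weightExponent hw, add_comm]
    rw [monomial_mem_weightedIdeal hw, hfloor, ha]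
    refine exists_congr fun i => and_congr_right fun _ => ?_
    have := hw i
    simp only [floorExponent_apply, Finsupp.add_apply, Finsupp.equivFunOnFinite_symm_apply_apply,
      ne_eq, Nat.div_eq_zero_iff]
    omega

theorem monomial_mem_symbolicPower_iff {I : Ideal (MvPolynomial (Fin n) K)}
    (hI : IsMonomialIdeal I) {s : ℕ} {a : Fin n →₀ ℕ} :
    monomial a (1 : K) ∈ symbolicPower I s ↔ ∀ A, IsAssocSet I A →
      ∃ b : Fin n →₀ ℕ, (∀ i ∈ A, b i = 0) ∧ monomial (a + b) (1 : K) ∈ I ^ s := by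
  classical
  simp [mem_symbolicPower_iff hI, support_monomial]

theorem symbolicPower_le_iff {I M : Ideal (MvPolynomial (Fin n) K)} (hI : IsMonomialIdeal I)
    (hM : IsMonomialIdeal M) {s : ℕ} : symbolicPower I s ≤ M ↔
      ∀ a, monomial a (1 : K) ∈ symbolicPower I s → monomial a (1 : K) ∈ M := by
  refine ⟨fun h a ha => h ha, fun h f hf => hM.mem_iff.2 fun a ha => h a ?_⟩
  exact (monomial_mem_symbolicPower_iff hI).2 ((mem_symbolicPower_iff hI).1 hf a ha)

theorem monomial_mem_symbolicPower_weightedIdeal {w : Fin n → ℕ} (hw : IsStandardWeighting w)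
    {I : Ideal (MvPolynomial (Fin n) K)} (hI : IsMonomialIdeal I) {s : ℕ} {a : Fin n →₀ ℕ} :
    monomial a (1 : K) ∈ symbolicPower (weightedIdeal w I) s ↔
      monomial (floorExponent w a) (1 : K) ∈ symbolicPower I s := by
  simp only [monomial_mem_symbolicPower_iff hI, weightedIdeal_pow w hI,
    monomial_mem_symbolicPower_iff (isMonomialIdeal_weightedIdeal w I),
    isAssocSet_weightedIdeal_iff hw, monomial_mem_weightedIdeal hw]
  refine forall₂_congr fun A _ => ⟨?_, ?_⟩
  · rintro ⟨b, hb, h⟩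
    have hle : floorExponent w a ≤ floorExponent w (a + b) := fun i => by
      simpa using Nat.div_le_div_right (Nat.le_add_right _ _)
    refine ⟨floorExponent w (a + b) - floorExponent w a, fun i hi => ?_, ?_⟩
    · simp [hb i hi]
    · rwa [add_tsub_cancel_of_le hle]
  · rintro ⟨b, hb, h⟩
    exact ⟨weightExponent w b, fun i hi => by simp [hb i hi],
      by rwa [floorExponent_add_weightExponent hw]⟩

theorem symbolicPower_weightedIdeal_le_iff {w : Fin n → ℕ} (hw : IsStandardWeighting w)
    {I : Ideal (MvPolynomial (Fin n) K)} (hI : IsMonomialIdeal I) (s t : ℕ) :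
    symbolicPower (weightedIdeal w I) s ≤ weightedIdeal w I ^ t ↔ symbolicPower I s ≤ I ^ t := by
  rw [symbolicPower_le_iff (isMonomialIdeal_weightedIdeal w I)
    ((isMonomialIdeal_weightedIdeal w I).pow t), symbolicPower_le_iff hI (hI.pow t)]
  simp only [weightedIdeal_pow w hI, monomial_mem_symbolicPower_weightedIdeal hw hI,
    monomial_mem_weightedIdeal hw]
  refine ⟨fun h a ha => ?_, fun h a => h _⟩
  simpa only [floorExponent_weightExponent hw] using
    h (weightExponent w a) (by rwa [floorExponent_weightExponent hw])

theorem resurgence_weightedIdeal {w : Fin n → ℕ} (hw : IsStandardWeighting w)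
    {I : Ideal (MvPolynomial (Fin n) K)} (hI : IsMonomialIdeal I) :
    resurgence (weightedIdeal w I) = resurgence I := by
  simp only [resurgence, symbolicPower_weightedIdeal_le_iff hw hI]

theorem asymptoticResurgence_weightedIdeal {w : Fin n → ℕ} (hw : IsStandardWeighting w)
    {I : Ideal (MvPolynomial (Fin n) K)} (hI : IsMonomialIdeal I) :
    asymptoticResurgence (weightedIdeal w I) = asymptoticResurgence I := by
  simp only [asymptoticResurgence, symbolicPower_weightedIdeal_le_iff hw hI]

/-! ### Squarefree monomial ideals -/

theorem IsSquarefreeMonomialIdeal.isMonomialIdeal {J : Ideal (MvPolynomial (Fin n) K)}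
    (hJ : IsSquarefreeMonomialIdeal J) : IsMonomialIdeal J :=
  let ⟨S, _, h⟩ := hJ; ⟨S, h⟩

theorem IsSquarefreeMonomialIdeal.mem_of_support_subset {J : Ideal (MvPolynomial (Fin n) K)}
    (hJ : IsSquarefreeMonomialIdeal J) {a b : Fin n →₀ ℕ} (ha : monomial a (1 : K) ∈ J)
    (hab : ∀ i, a i ≠ 0 → b i ≠ 0) : monomial b (1 : K) ∈ J := by
  obtain ⟨S, hS, rfl⟩ := hJ
  rw [mem_ideal_span_monomial_image] at ha
  obtain ⟨c, hc, hca⟩ := ha a (by simp)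
  refine monomial_mem_of_le (fun i => ?_) (Ideal.subset_span ⟨c, hc, rfl⟩)
  have h1 := hS c hc i
  have h2 := hca i
  have h3 := hab i
  omega

theorem IsSquarefreeMonomialIdeal.mem_of_mem_radical {J : Ideal (MvPolynomial (Fin n) K)}
    (hJ : IsSquarefreeMonomialIdeal J) {a : Fin n →₀ ℕ}
    (ha : monomial a (1 : K) ∈ J.radical) : monomial a (1 : K) ∈ J := by
  obtain ⟨N, hN⟩ := ha
  rw [monomial_pow, one_pow] at hN
  exact hJ.mem_of_support_subset hN fun i hi h => hi (by simp [h])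

theorem IsAssocSet.exists_ne_zero {I : Ideal (MvPolynomial (Fin n) K)} {A : Set (Fin n)}
    (hA : IsAssocSet I A) {c : Fin n →₀ ℕ} (hc : monomial c (1 : K) ∈ I) :
    ∃ i ∈ A, c i ≠ 0 := by
  obtain ⟨a, ha⟩ := hA
  exact (ha c).1 (monomial_mem_of_le le_add_self hc)

theorem IsAssocSet.le_varIdeal {I : Ideal (MvPolynomial (Fin n) K)} (hI : IsMonomialIdeal I)
    {A : Set (Fin n)} (hA : IsAssocSet I A) : I ≤ varIdeal K A :=
  fun _ hf => mem_varIdeal.2 fun _ ha => hA.exists_ne_zero (hI.mem_iff.1 hf _ ha)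

/-- The exponent of the product of the variables with index in `C`. -/
def indicatorExponent (C : Finset (Fin n)) : Fin n →₀ ℕ :=
  Finsupp.equivFunOnFinite.symm (fun i => if i ∈ C then 1 else 0)

@[simp] theorem indicatorExponent_apply (C : Finset (Fin n)) (i : Fin n) :
    indicatorExponent C i = if i ∈ C then 1 else 0 := rfl

theorem prod_X_eq_monomial (C : Finset (Fin n)) :
    ∏ i ∈ C, (X i : MvPolynomial (Fin n) K) = monomial (indicatorExponent C) 1 := by
  rw [monomial_eq, C_1, one_mul, Finsupp.prod_fintype _ _ (by simp)]
  simp [Finset.prod_ite_mem]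

/-- A squarefree monomial ideal is the intersection of its associated primes. -/
theorem IsSquarefreeMonomialIdeal.mem_of_forall_isAssocSet
    {J : Ideal (MvPolynomial (Fin n) K)} (hJ : IsSquarefreeMonomialIdeal J) {c : Fin n →₀ ℕ}
    (hc : ∀ A, IsAssocSet J A → ∃ i ∈ A, c i ≠ 0) : monomial c (1 : K) ∈ J := by
  classical
  by_contra hcJ
  have hB : ∀ a : Fin n →₀ ℕ, monomial a (1 : K) ∈ J → ∃ i ∈ {i | c i = 0}, a i ≠ 0 := by
    intro a ha
    by_contra! h
    exact hcJ (hJ.mem_of_support_subset ha fun i hi hci => hi (h i hci))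
  obtain ⟨A, hAB, hA⟩ := exists_minimal_le_of_wellFoundedLT (fun B : Set (Fin n) =>
    ∀ a : Fin n →₀ ℕ, monomial a (1 : K) ∈ J → ∃ i ∈ B, a i ≠ 0) _ hB
  have hassoc : IsAssocSet J A := by
    -- `A` is a minimal set of variables meeting every monomial of `J`; the witness is the product
    -- of all variables outside it.
    refine ⟨indicatorExponent (Finset.univ.filter (· ∉ A)), fun b => ⟨fun h => ?_, ?_⟩⟩
    · obtain ⟨i, hi, h'⟩ := hA.1 _ h
      exact ⟨i, hi, by simpa [hi] using h'⟩
    · rintro ⟨i, hi, hbi⟩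
      -- By minimality, some monomial of `J` involves no variable of `A` other than `x_i`, so its
      -- support lies in that of the witness times `x ^ b`.
      have hnot : ¬ ∀ a : Fin n →₀ ℕ, monomial a (1 : K) ∈ J → ∃ j ∈ A \ {i}, a j ≠ 0 :=
        fun h => (hA.2 h Set.sdiff_subset hi).2 rfl
      push Not at hnot
      obtain ⟨a, ha, haA⟩ := hnot
      refine hJ.mem_of_support_subset ha fun j hj => ?_
      by_cases hjA : j ∈ A
      · obtain rfl : j = i := by
          by_contra hji
          exact hj (haA j ⟨hjA, hji⟩)
        simp [hbi]
      · simp [hjA]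
  obtain ⟨i, hi, hci⟩ := hc A hassoc
  exact hci (hAB hi)

theorem le_sum_of_monomial_mem_pow {A : Finset (Fin n)} {I : Ideal (MvPolynomial (Fin n) K)}
    (hI : I ≤ varIdeal K (A : Set (Fin n))) {s : ℕ} {a : Fin n →₀ ℕ}
    (ha : monomial a (1 : K) ∈ I ^ s) : s ≤ ∑ i ∈ A, a i := by
  classical
  have key : ∀ s : ℕ, I ^ s ≤ Ideal.span ((fun a => monomial a (1 : K)) ''
      {a : Fin n →₀ ℕ | s ≤ ∑ i ∈ A, a i}) := by
    intro s
    induction s with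
    | zero =>
      have : (1 : MvPolynomial (Fin n) K) ∈ Ideal.span ((fun a => monomial a (1 : K)) ''
          {a : Fin n →₀ ℕ | 0 ≤ ∑ i ∈ A, a i}) := Ideal.subset_span ⟨0, by simp, rfl⟩
      rw [(Ideal.eq_top_iff_one _).2 this]
      exact le_top
    | succ s ih =>
      rw [pow_succ]
      refine (Ideal.mul_mono ih hI).trans ?_
      rw [varIdeal, Ideal.span_mul_span', Ideal.span_le]
      rintro _ ⟨_, ⟨a, ha, rfl⟩, _, ⟨i, hi, rfl⟩, rfl⟩
      refine Ideal.subset_span ⟨a + Finsupp.single i 1, ?_, by simp [X, monomial_mul]⟩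
      have h1 : ∑ j ∈ A, (Finsupp.single i 1 : Fin n →₀ ℕ) j = 1 := by
        simp [Finsupp.single_apply, Finset.mem_coe.1 hi]
      have h2 : s ≤ ∑ j ∈ A, a j := ha
      simp only [Set.mem_ofPred_eq, Finsupp.add_apply, Finset.sum_add_distrib, h1]
      omega
  obtain ⟨c, hc, hca⟩ := mem_ideal_span_monomial_image.1 (key s ha) a (by simp)
  exact le_trans hc (Finset.sum_le_sum fun i _ => hca i)

theorem le_sum_of_monomial_mem_symbolicPower {I : Ideal (MvPolynomial (Fin n) K)}
    (hI : IsMonomialIdeal I) {A : Finset (Fin n)} (hA : IsAssocSet I (A : Set (Fin n)))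
    {s : ℕ} {a : Fin n →₀ ℕ} (ha : monomial a (1 : K) ∈ symbolicPower I s) :
    s ≤ ∑ i ∈ A, a i := by
  obtain ⟨b, hb, hab⟩ := (monomial_mem_symbolicPower_iff hI).1 ha A hA
  refine (le_sum_of_monomial_mem_pow (hA.le_varIdeal hI) hab).trans (le_of_eq ?_)
  exact Finset.sum_congr rfl fun i hi => by simp [hb i hi]

theorem card_le_bigHeight {I : Ideal (MvPolynomial (Fin n) K)} (hI : IsMonomialIdeal I)
    {A : Finset (Fin n)} (hA : IsAssocSet I (A : Set (Fin n))) :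
    (A.card : ℕ∞) ≤ bigHeight I :=
  (card_le_height_varIdeal A).trans
    (le_iSup₂ (f := fun (p : Ideal (MvPolynomial (Fin n) K)) (_ : IsAssocPrime I p) => p.height)
      _ (hA.isAssocPrime hI))

theorem weightedIdeal_le {w : Fin n → ℕ} (hw : IsStandardWeighting w)
    (J : Ideal (MvPolynomial (Fin n) K)) : weightedIdeal w J ≤ J := by
  rw [weightedIdeal, Ideal.span_le]
  rintro _ ⟨a, ha, rfl⟩
  exact monomial_mem_of_le (fun i => Nat.le_mul_of_pos_left _ (hw i)) ha

/-! ### Containments between symbolic and ordinary powers -/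

/-- A product of covers, each repeated `τ` times, lies in the power of the ideal. -/
theorem monomial_mem_pow_of_sum_le {I : Ideal (MvPolynomial (Fin n) K)} {k τ : ℕ}
    (C : Fin k → (Fin n →₀ ℕ)) (hC : ∀ j, monomial (C j) (1 : K) ∈ I) {a : Fin n →₀ ℕ}
    (ha : ∀ i, ∑ j, τ * C j i ≤ a i) : monomial a (1 : K) ∈ I ^ (k * τ) := by
  have h1 : ∏ j, (monomial (C j) (1 : K)) ^ τ ∈ I ^ (k * τ) := by
    have : (∏ _j : Fin k, I ^ τ) = I ^ (k * τ) := by simp [← pow_mul, mul_comm]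
    rw [← this]
    exact Ideal.prod_mem_prod fun j _ => Ideal.pow_mem_pow (hC j) τ
  have h2 : ∏ j, (monomial (C j) (1 : K)) ^ τ = monomial (∑ j, τ • C j) (1 : K) := by
    simp only [monomial_pow, one_pow, monomial_sum_one]
  rw [h2] at h1
  refine monomial_mem_of_le (fun i => ?_) h1
  simpa [Finsupp.finsetSum_apply] using ha i

theorem symbolicPower_le_pow_of_mul_le {J : Ideal (MvPolynomial (Fin n) K)}
    (hJ : IsSquarefreeMonomialIdeal J) {h : ℕ}
    (hh : ∀ A : Finset (Fin n), IsAssocSet J (A : Set (Fin n)) → A.card ≤ h) {s t : ℕ}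
    (hs : 0 < s) (hst : h * t ≤ s) : symbolicPower J s ≤ J ^ t := by
  classical
  have hM := hJ.isMonomialIdeal
  rw [symbolicPower_le_iff hM (hM.pow t)]
  intro a ha
  have hC : monomial (indicatorExponent (Finset.univ.filter (fun i => t ≤ a i))) (1 : K) ∈ J := by
    refine hJ.mem_of_forall_isAssocSet fun A hA => ?_
    lift A to Finset (Fin n) using A.toFinite
    have h1 := le_sum_of_monomial_mem_symbolicPower hM hA ha
    by_contra! hcon
    have hlt : ∀ i ∈ A, a i < t := fun i hi => by simpa using hcon i hi
    -- The empty set is associated when `J = 0`; there the sum bound reads `s ≤ 0`, and `0 < s` is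
    -- needed.
    rcases A.eq_empty_or_nonempty with rfl | hne
    · simp at h1
      omega
    · have h2 : ∑ i ∈ A, a i < ∑ _i ∈ A, t := Finset.sum_lt_sum_of_nonempty hne hlt
      rw [Finset.sum_const, smul_eq_mul] at h2
      have h3 := Nat.mul_le_mul_right t (hh A hA)
      omega
  have := monomial_mem_pow_of_sum_le (k := 1) (τ := t) (fun _ => _) (fun _ => hC) (a := a)
    (fun i => by by_cases hi : t ≤ a i <;> simp [hi])
  simpa using this

/-- A vertex with `a i ≥ k τ` may enter the covers of all `k` colours; one with only `a i ≥ (k - 1)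
τ` may enter all except that of its own colour. Each vertex then uses at most `a i` of the exponent
when every cover is repeated `τ` times. -/
theorem symbolicPower_le_pow_of_colouring {J : Ideal (MvPolynomial (Fin n) K)}
    (hJ : IsSquarefreeMonomialIdeal J) {h : ℕ}
    (hh : ∀ A : Finset (Fin n), IsAssocSet J (A : Set (Fin n)) → A.card ≤ h) {k : ℕ}
    (c : Fin n → Fin k)
    (hc : ∀ j, monomial (indicatorExponent (Finset.univ.filter (fun i => c i ≠ j))) (1 : K) ∈ J)
    {s τ : ℕ} (hs : h * (k * τ) ≤ s + τ) : symbolicPower J s ≤ J ^ (k * τ) := by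
  classical
  have hM := hJ.isMonomialIdeal
  rw [symbolicPower_le_iff hM (hM.pow _)]
  intro a ha
  refine monomial_mem_pow_of_sum_le (fun j => indicatorExponent (Finset.univ.filter
    (fun i => k * τ ≤ a i ∨ (k * τ ≤ a i + τ ∧ c i ≠ j)))) (fun j => ?_) fun i => ?_
  · refine hJ.mem_of_forall_isAssocSet fun A hA => ?_
    lift A to Finset (Fin n) using A.toFinite
    by_cases hbig : ∃ i ∈ A, k * τ ≤ a i
    · obtain ⟨i, hi, hai⟩ := hbig
      exact ⟨i, hi, by simp [hai]⟩
    push Not at hbig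
    -- Some vertex `i` of `A` avoids the colour `j`. The at most `h - 1` other vertices contribute
    -- at most `k τ` each, so `a i ≥ s - (h - 1) k τ ≥ (k - 1) τ`, and `i` belongs to the cover of
    -- `j`.
    obtain ⟨i, hi, hij⟩ := hA.exists_ne_zero (hc j)
    have hij : c i ≠ j := by simpa using hij
    refine ⟨i, hi, ?_⟩
    have h1 := le_sum_of_monomial_mem_symbolicPower hM hA ha
    have hi' : i ∈ A := hi
    rw [← Finset.add_sum_erase A _ hi'] at h1
    have h2 : ∑ l ∈ A.erase i, a l ≤ (A.erase i).card * (k * τ) := by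
      rw [← smul_eq_mul]
      exact Finset.sum_le_card_nsmul _ _ _ fun l hl => (hbig l (Finset.mem_of_mem_erase hl)).le
    have h3 : (A.erase i).card + 1 ≤ h := by
      rw [Finset.card_erase_add_one hi']
      exact hh A hA
    have h4 := Nat.mul_le_mul_right (k * τ) h3
    rw [add_mul, one_mul] at h4
    have h5 : k * τ ≤ a i + τ := by omega
    simp [h5, hij]
  · rw [← Finset.mul_sum]
    by_cases h1 : k * τ ≤ a i
    · simp [h1, mul_comm]
    by_cases h2 : k * τ ≤ a i + τ
    · have hsum : ∑ j, (if c i ≠ j then 1 else 0) + 1 = k := by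
        have h3 := Finset.card_erase_add_one (Finset.mem_univ (c i))
        rw [Finset.card_univ, Fintype.card_fin] at h3
        rw [Finset.sum_boole, Finset.filter_ne]
        exact h3
      have h4 := congrArg (τ * ·) hsum
      simp only [mul_add, mul_one, mul_comm τ k] at h4
      simp only [indicatorExponent_apply, Finset.mem_filter, Finset.mem_univ, true_and, h1, h2,
        false_or]
      omega
    · simp [h1, h2]

/-! ### Bounds for the asymptotic resurgence -/

/-- A pair counts towards `ρ_a` only if containment fails for all large `p`, so infinitely many
successes exclude it. -/
theorem asymptoticResurgence_le_of_frequently {I : Ideal (MvPolynomial (Fin n) K)} {r : EReal}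
    (hr : ∀ s t : ℕ, 0 < s → 0 < t → r < (((s : ℝ) / (t : ℝ) : ℝ) : EReal) →
      ∃ᶠ p : ℕ in Filter.atTop, symbolicPower I (s * p) ≤ I ^ (t * p)) :
    asymptoticResurgence I ≤ r := by
  refine sSup_le ?_
  rintro _ ⟨s, t, hs, ht, hev, rfl⟩
  by_contra! hlt
  obtain ⟨p, hp, hp'⟩ := ((hr s t hs ht hlt).and_eventually hev).exists
  exact hp' hp

theorem asymptoticResurgence_le_bigHeight {J : Ideal (MvPolynomial (Fin n) K)}
    (hJ : IsSquarefreeMonomialIdeal J) {h : ℕ}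
    (hh : ∀ A : Finset (Fin n), IsAssocSet J (A : Set (Fin n)) → A.card ≤ h) :
    asymptoticResurgence J ≤ ((h : ℝ) : EReal) := by
  refine asymptoticResurgence_le_of_frequently fun s t hs ht hlt => ?_
  rw [EReal.coe_lt_coe_iff, lt_div_iff₀ (by positivity)] at hlt
  have hlt : h * t < s := by exact_mod_cast hlt
  refine Filter.Eventually.frequently ?_
  filter_upwards [Filter.eventually_gt_atTop 0] with p hp
  refine symbolicPower_le_pow_of_mul_le hJ hh (by positivity) ?_
  rw [← mul_assoc]
  exact Nat.mul_le_mul_right p hlt.le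

theorem asymptoticResurgence_le_of_colouring {J : Ideal (MvPolynomial (Fin n) K)}
    (hJ : IsSquarefreeMonomialIdeal J) {h : ℕ}
    (hh : ∀ A : Finset (Fin n), IsAssocSet J (A : Set (Fin n)) → A.card ≤ h) {k : ℕ}
    (hk : 0 < k) (c : Fin n → Fin k)
    (hc : ∀ j, monomial (indicatorExponent (Finset.univ.filter (fun i => c i ≠ j))) (1 : K) ∈ J) :
    asymptoticResurgence J ≤ (((h : ℝ) - 1 / (k : ℝ) : ℝ) : EReal) := by
  refine asymptoticResurgence_le_of_frequently fun s t hs ht hlt => ?_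
  have hk' : (0 : ℝ) < k := by exact_mod_cast hk
  have ht' : (0 : ℝ) < t := by exact_mod_cast ht
  rw [EReal.coe_lt_coe_iff, lt_div_iff₀ ht', sub_mul, sub_lt_iff_lt_add, div_mul_eq_mul_div,
    one_mul, ← sub_lt_iff_lt_add', lt_div_iff₀ hk', sub_mul, sub_lt_iff_lt_add] at hlt
  have hlt : h * t * k < t + s * k := by exact_mod_cast hlt
  rw [Filter.frequently_atTop]
  intro N
  -- Taking `p` a multiple of `k` puts `t * p` in the form `k * τ` with `τ = t * N`.
  refine ⟨k * N, Nat.le_mul_of_pos_left _ hk, ?_⟩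
  rw [show t * (k * N) = k * (t * N) by ring]
  refine symbolicPower_le_pow_of_colouring hJ hh c hc ?_
  nlinarith [Nat.mul_le_mul_right N hlt.le]

/-! ### Colourings of hypergraphs -/

theorem exists_isColorable_of_chromaticNumber_ne_top {V : Type*} {H : Hypergraph V}
    (hH : chromaticNumber H ≠ ⊤) : ∃ k : ℕ, chromaticNumber H = k ∧ IsColorable H k := by
  classical
  have hex : ∃ k, IsColorable H k := by
    by_contra! h
    exact hH (by simp [chromaticNumber, h])
  refine ⟨Nat.find hex, le_antisymm (iInf₂_le _ (Nat.find_spec hex)) ?_, Nat.find_spec hex⟩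
  exact le_iInf₂ fun k hk => by exact_mod_cast Nat.find_min' hex hk

/-- Without colours there can be no edges, so the empty set is a cover. This is how `I ≠ ⊤` forces
`0 < k` in the final bound. -/
theorem coverIdeal_eq_top_of_isColorable_zero {H : Hypergraph (Fin n)} (hH : IsColorable H 0) :
    coverIdeal K H = ⊤ := by
  obtain ⟨c, hc⟩ := hH
  rw [Ideal.eq_top_iff_one]
  refine Ideal.subset_span ⟨∅, ⟨by simp, fun e he => ?_⟩, by simp⟩
  obtain ⟨x, -⟩ := hc e he
  exact (c x).elim0

/-- The complement of a colour class is a vertex cover. -/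
theorem exists_colouring_mem_coverIdeal {H : Hypergraph (Fin n)} (hV : H.vertexSet = Set.univ)
    {k : ℕ} (hH : IsColorable H k) : ∃ c : Fin n → Fin k, ∀ j,
      monomial (indicatorExponent (Finset.univ.filter (fun i => c i ≠ j))) (1 : K) ∈
        coverIdeal K H := by
  obtain ⟨c, hc⟩ := hH
  refine ⟨fun i => c ⟨i, hV ▸ Set.mem_univ i⟩, fun j => ?_⟩
  refine Ideal.subset_span ⟨_, ⟨fun i _ => hV ▸ Set.mem_univ i, fun e he => ?_⟩,
    (prod_X_eq_monomial _).symm⟩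
  obtain ⟨x, y, hx, hy, hxy⟩ := hc e he
  by_cases hj : c x = j
  · exact ⟨y, by simpa using fun h => hxy (hj.trans h.symm), hy⟩
  · exact ⟨x, by simpa using hj, hx⟩

theorem asymptoticResurgence_le_sub_inv_chromaticNumber
    {I : Ideal (MvPolynomial (Fin n) K)} {h : ℕ} (hI : HasStandardLinearWeighting I)
    (hne : I ≠ ⊤) (hh : bigHeight I = (h : ℕ∞)) {H : Hypergraph (Fin n)}
    (hH : IsHypergraphOf H I) : asymptoticResurgence I ≤
      ((h : ℝ) : EReal) - 1 / (((chromaticNumber H : ℕ∞) : ENNReal) : EReal) := by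
  obtain ⟨J, w, hJ, hw, rfl⟩ := hI
  have hM := hJ.isMonomialIdeal
  rw [asymptoticResurgence_weightedIdeal hw hM]
  have hcard : ∀ A : Finset (Fin n), IsAssocSet J (A : Set (Fin n)) → A.card ≤ h := by
    intro A hA
    have := card_le_bigHeight (isMonomialIdeal_weightedIdeal w J)
      ((isAssocSet_weightedIdeal_iff hw).2 hA)
    rw [hh] at this
    exact_mod_cast this
  by_cases hχ : chromaticNumber H = ⊤
  · simpa [hχ] using asymptoticResurgence_le_bigHeight hJ hcard
  · obtain ⟨k, hk, hcol⟩ := exists_isColorable_of_chromaticNumber_ne_top hχ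
    have hk0 : 0 < k := by
      rw [Nat.pos_iff_ne_zero]
      rintro rfl
      have := hH.2
      rw [coverIdeal_eq_top_of_isColorable_zero hcol, eq_comm, Ideal.radical_eq_top] at this
      exact hne this
    obtain ⟨c, hc⟩ := exists_colouring_mem_coverIdeal (K := K) hH.1 hcol
    -- The covers pass to `J` through `√(J_w) ⊆ √J`, and a squarefree `J` contains every monomial of
    -- `√J`.
    have := asymptoticResurgence_le_of_colouring hJ hcard hk0 c fun j =>
      hJ.mem_of_mem_radical (Ideal.radical_mono (weightedIdeal_le hw J) (hH.2 ▸ hc j))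
    refine this.trans (le_of_eq ?_)
    have hcast : (((k : ℕ∞) : ENNReal) : EReal) = ((k : ℝ) : EReal) := by
      rw [ENat.toENNReal_coe]
      rfl
    rw [hk, hcast, EReal.coe_sub, EReal.coe_div, EReal.coe_one]

end MonomialResurgence

end

theorem mainTheorem6 {K : Type*} [Field K] {n : ℕ} (I : Ideal (MvPolynomial (Fin n) K))
    (hI : MonomialResurgence.IsMonomialIdeal I) :
    (∀ w : Fin n → ℕ, MonomialResurgence.IsStandardWeighting w →
      MonomialResurgence.resurgence (MonomialResurgence.weightedIdeal w I) =
          MonomialResurgence.resurgence I ∧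
        MonomialResurgence.asymptoticResurgence (MonomialResurgence.weightedIdeal w I) =
          MonomialResurgence.asymptoticResurgence I) ∧
    (∀ h : ℕ, MonomialResurgence.HasStandardLinearWeighting I → I ≠ ⊤ →
      MonomialResurgence.bigHeight I = (h : ℕ∞) →
      ∀ H : Hypergraph (Fin n), MonomialResurgence.IsHypergraphOf H I →
        MonomialResurgence.asymptoticResurgence I ≤
          ((h : ℝ) : EReal) -
            1 / (((MonomialResurgence.chromaticNumber H : ℕ∞) : ENNReal) : EReal)) :=
  ⟨fun _ hw => ⟨MonomialResurgence.resurgence_weightedIdeal hw hI,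
    MonomialResurgence.asymptoticResurgence_weightedIdeal hw hI⟩,
   fun _ hlin hne hh _ hH =>
    MonomialResurgence.asymptoticResurgence_le_sub_inv_chromaticNumber hlin hne hh hH⟩
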